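/- Consider $n$ synchronous agents, each with an initial value in $\{0,1\}$, of whom at most $t<n$ may crash: an agent that crashes in a round delivers an arbitrary subset of its messages of that round and sends nothing and does not run the protocol afterwards. In the \emph{Vectorized FloodSet} exchange, agent $i$ keeps a vector $V_i$ of initial values, indexed by the agents (with $\bot$ for unknown entries; initially only its own entry is known), and a set $New_i$ of pairs (value, agent) (initially its own value). In each round it sends $New_i$, if nonempty, to every other agent; it then fills in the $\bot$ entries of $V_i$ that the received messages determine, and lets $New_i$ be the set of pairs that were newly filled in. Its local state at time $m$ (after $m$ rounds) is $(V_i,New_i,m)$, or $\mathit{crashed}$. Let $\mathcal I$ be the system of all runs, one for each choice of initial values and failure pattern; two points are indistinguishable to $i$ if $i$ has the same local state at both. Let $\mathcal N$ be the indexical set of nonfailed agents, let $C_{\mathcal N}$ be the corresponding common knowledge operator, let $\exists v$ be the proposition that some agent has initial value $v$, and let $\beta_i(r,m)$ be the number of $\bot$ entries of $V_i$ at the point $(r,m)$. \textbf{Theorem.} (1) Let $r$ be a run, $m$ a time and $i\in\mathcal N(r,m)$; if $t+2<n$, suppose that $m\ge 1$. Then $$(\mathcal I,r,m)\models C_{\mathcal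 N}(\exists 0)\lor C_{\mathcal N}(\exists 1)\quad\Longleftrightarrow\quad m>\min\{t+1,n-1\}-\max\{1,\beta_i(r,m)\}.$$ (2) Consider the rule by which agent $i$ decides at time $m$ if this inequality holds (and $m\ge1$ in case $t+2<n$), on $0$ if $0$ occurs in $V_i$ and on $1$ otherwise. It solves Simultaneous Byzantine Agreement, that is: any two decisions of nonfailed agents in a run are equal; a value decided is some agent's initial value; and if a nonfailed agent decides in a round, then all nonfailed agents decide in that round. It is an optimum such protocol for this exchange: at every point at which some decision protocol satisfying these conditions makes a nonfailed agent decide, this rule also makes it decide. (3) With this rule, every agent that is nonfailed at time $t+1$ has decided by time $t+1$; and if $t\ge 2$ or $n=t+1$, there is a run in which a nonfailed agent decides at some time before $t+1$. -/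

import Mathlib

namespace VecFloodSet

/-- Initial preferences / decision values. -/
abbrev Value := Fin 2

/-- A set of pairs (v, k), each saying that agent k has initial value v.  This is the type of
the messages and of the `New` component of the local states. -/
abbrev Info (n : ℕ) := Finset (Value × Fin n)

/-- Local states: the state of a crashed agent, or the value vector (`none` is the unknown
entry ⊥), the set of pairs first learned in the latest round, and the clock. -/
inductive LocalState (n : ℕ) where
  | crashed : LocalState n
  | active (V : Fin n → Option Value) (New : Info n) (time : ℕ) : LocalState n

inductive Action where
  | decide (v : Value) : Action
  | noop : Action

/-! ### The crash failure model

`F m i j = false` means that the message (if any) from `i` to `j` in round `m + 1`, i.e. between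
times `m` and `m + 1`, is not delivered; `F m i i = false` means that `i` crashes in that round
or has crashed before. -/

structure IsCrashAdversary (n t : ℕ) (F : ℕ → Fin n → Fin n → Bool) : Prop where
  /-- an agent that loses a message crashes in that round (or has crashed before) -/
  crash_of_lost : ∀ m i j, F m i j = false → F m i i = false
  /-- an agent sends nothing in the rounds after its crash -/
  silent_after : ∀ m i, F m i i = false → ∀ m', m < m' → ∀ j, F m' i j = false
  /-- at most `t` agents are faulty -/
  card_faulty : {i : Fin n | ∃ m j, F m i j = false}.ncard ≤ t

/-! ### The information exchange

Neither the messages nor the state updates depend on the actions of the agents, so that the runs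
of the exchange are the same for all decision protocols. -/

def initState {n : ℕ} (i : Fin n) (v : Value) : LocalState n :=
  .active (fun k => if k = i then some v else none) {(v, i)} 0

/-- The message that `i`, in state `s`, sends to `j`: its new information, if there is any. -/
def message {n : ℕ} (i : Fin n) (s : LocalState n) (j : Fin n) : Option (Info n) :=
  match s with
  | .crashed => none
  | .active _ New _ => if New ≠ ∅ ∧ j ≠ i then some New else none

/-- All the pairs in the messages received (no message counts as the empty message). -/
def received {n : ℕ} (msgs : Fin n → Option (Info n)) : Info n :=
  Finset.univ.biUnion fun j => (msgs j).getD ∅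

/-- The value vector after filling in unknown entries.  (Pairs that occur in runs carry actual
initial values, so that there is never a conflict and the order of processing is irrelevant.) -/
def updateVec {n : ℕ} (V : Fin n → Option Value) (W : Info n) : Fin n → Option Value :=
  fun k =>
    if V k = none then
      if (0, k) ∈ W then some 0 else if (1, k) ∈ W then some 1 else none
    else V k

/-- The pairs that were filled in. -/
def newInfo {n : ℕ} (V V' : Fin n → Option Value) : Info n :=
  Finset.univ.filter fun p => V p.2 = none ∧ V' p.2 = some p.1

/-- State update of agent `i` in environment state `F` upon receiving `msgs`. -/
def transition {n : ℕ} (F : ℕ → Fin n → Fin n → Bool) (i : Fin n) (s : LocalState n)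
    (msgs : Fin n → Option (Info n)) : LocalState n :=
  match s with
  | .crashed => .crashed
  | .active V _ m =>
      if F m i i = false then .crashed
      else .active (updateVec V (received msgs))
        (newInfo V (updateVec V (received msgs))) (m + 1)

/-- A run is determined by the adversary and the initial values. -/
structure Run (n t : ℕ) where
  F : ℕ → Fin n → Fin n → Bool
  isCrash : IsCrashAdversary n t F
  init : Fin n → Value

/-- The local states of the agents at each time of a run. -/
def Run.state {n t : ℕ} (r : Run n t) : ℕ → Fin n → LocalState n
  | 0 => fun i => initState i (r.init i)
  | m + 1 => fun i => transition r.F i (r.state m i)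
      fun j => if r.F m j i = true then message j (r.state m j) i else none

/-- The agent `i` belongs to the set 𝒩(r, m) of nonfailed agents. -/
def Run.Nonfailed {n t : ℕ} (r : Run n t) (m : ℕ) (i : Fin n) : Prop :=
  r.state m i ≠ .crashed

/-- The number of ⊥ entries in the value vector. -/
def unknowns {n : ℕ} : LocalState n → ℕ
  | .crashed => 0
  | .active V _ _ => (Finset.univ.filter fun k => V k = none).card

/-- `β_i(r, m)` -/
def Run.beta {n t : ℕ} (r : Run n t) (m : ℕ) (i : Fin n) : ℕ := unknowns (r.state m i)

/-! ### Knowledge -/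

abbrev Point (n t : ℕ) := Run n t × ℕ

/-- Formulas, identified with their sets of points. -/
abbrev Formula (n t : ℕ) := Point n t → Prop

def Indist {n t : ℕ} (i : Fin n) (p q : Point n t) : Prop :=
  p.1.state p.2 i = q.1.state q.2 i

/-- `K_i φ` -/
def K {n t : ℕ} (i : Fin n) (φ : Formula n t) : Formula n t :=
  fun p => ∀ q, Indist i p q → φ q

/-- `E_𝒩 φ` -/
def E {n t : ℕ} (φ : Formula n t) : Formula n t :=
  fun p => ∀ i, p.1.Nonfailed p.2 i → K i φ p

/-- `C_𝒩 φ` -/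
def C {n t : ℕ} (φ : Formula n t) : Formula n t :=
  fun p => ∀ k : ℕ, 1 ≤ k → (E^[k]) φ p

/-- `∃v`: some agent has initial value `v`. -/
def existsValue {n t : ℕ} (v : Value) : Formula n t :=
  fun p => ∃ i, p.1.init i = v

/-! ### Decision protocols -/

abbrev DecisionProtocol (n : ℕ) := Fin n → LocalState n → Action

/-- `P` makes nonfailed `i` decide `v` at time `m` of `r` (i.e. in round `m + 1`). -/
def Decides {n t : ℕ} (P : DecisionProtocol n) (r : Run n t) (m : ℕ) (i : Fin n)
    (v : Value) : Prop :=
  r.Nonfailed m i ∧ P i (r.state m i) = .decide v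

/-- Simultaneous Byzantine Agreement (termination is stated separately, so that optimality below
is relative to the larger class of protocols). -/
structure IsSBA {n : ℕ} (t : ℕ) (P : DecisionProtocol n) : Prop where
  agreement : ∀ (r : Run n t) m m' i j v v', Decides P r m i v → Decides P r m' j v' → v = v'
  validity : ∀ (r : Run n t) m i v, Decides P r m i v → ∃ j, r.init j = v
  simultaneity : ∀ (r : Run n t) m i v, Decides P r m i v →
    ∀ j, r.Nonfailed m j → ∃ w, Decides P r m j w

/-- `P ≤ Q`: whenever `P` decides, so does `Q` in the corresponding run. -/
def DecidesNoEarlier {n : ℕ} (t : ℕ) (P Q : DecisionProtocol n) : Prop :=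
  ∀ (r : Run n t) m i v, Decides P r m i v → ∃ w, Decides Q r m i w

def IsOptimumSBA {n : ℕ} (t : ℕ) (P : DecisionProtocol n) : Prop :=
  IsSBA t P ∧ ∀ P' : DecisionProtocol n, IsSBA t P' → DecidesNoEarlier t P' P

/-- `m > min{t+1, n-1} - max{1, β}`, over the integers. -/
def StopCond (n t m β : ℕ) : Prop :=
  (m : ℤ) > min ((t : ℤ) + 1) ((n : ℤ) - 1) - max 1 (β : ℤ)

open Classical in
/-- The early-stopping rule: decide as soon as the stopping condition holds (not before round 1
when `t + 2 < n`), on 0 if 0 occurs in the value vector and on 1 otherwise. -/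
noncomputable def stopRule (n t : ℕ) : DecisionProtocol n := fun _ s =>
  match s with
  | .crashed => .noop
  | .active V _ m =>
      if (0 < m ∨ n ≤ t + 2) ∧ StopCond n t m (Finset.univ.filter fun k => V k = none).card then
        if ∃ k, V k = some 0 then .decide 0 else .decide 1
      else .noop

end VecFloodSet

/-!
A nonfailed agent knows exactly the initial values of the agents from which a chain of delivered
messages leads to it. If in some round nobody crashes, then after it all nonfailed agents have heard
from the same agents, and this stays so. Otherwise every round has a crash, and the agents still
unheard of have all crashed in the first round; so the inequality forces the nonfailed agents to
have equal vectors, the stopping rule is simultaneous, and its decisions are common knowledge.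

Conversely, suppose the inequality fails. There are then enough possible crashes for a relay: agents
that crash in round 1 are heard of only by one agent, which crashes in round 2 having told only one
other agent, and so on. A run of this kind looks to the last agent of the relay as if the agents had
not crashed, and to the others as if they had been silent. Hence all points that fail the inequality
at a given time are connected by indistinguishability to the failure-free runs, whatever the initial
values, and no `∃v` is common knowledge.
-/

namespace VecFloodSet

variable {n t : ℕ}

/-! ### Common knowledge as reachability -/

/-- One step of the reachability relation behind `C_𝒩`: some agent that is nonfailed at `p` cannot
tell `p` from `q`. -/
def Linked (p q : Point n t) : Prop := ∃ i, p.1.Nonfailed p.2 i ∧ Indist i p q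

/-- Reachability of `q` from `p` by steps of indistinguishability for nonfailed agents. Connected
points have the same common knowledge. -/
abbrev Connected (p q : Point n t) : Prop := Relation.ReflTransGen Linked p q

lemma Indist.nonfailed {p q : Point n t} {i : Fin n} (h : Indist i p q)
    (hi : p.1.Nonfailed p.2 i) : q.1.Nonfailed q.2 i := by
  rwa [Run.Nonfailed, ← show p.1.state p.2 i = q.1.state q.2 i from h]

lemma Indist.connected {p q : Point n t} {i : Fin n} (h : Indist i p q)
    (hi : p.1.Nonfailed p.2 i) : Connected p q :=
  .single ⟨i, hi, h⟩

lemma Linked.symm {p q : Point n t} : Linked p q → Linked q p := fun ⟨i, hi, h⟩ =>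
  ⟨i, h.nonfailed hi, Eq.symm h⟩

lemma Connected.symm {p q : Point n t} (h : Connected p q) : Connected q p := by
  induction h with
  | refl => exact .refl
  | tail _ hqs ih => exact .head hqs.symm ih

lemma E_iff_forall_linked {φ : Formula n t} {p : Point n t} :
    E φ p ↔ ∀ q, Linked p q → φ q :=
  ⟨fun h q ⟨i, hi, hq⟩ => h i hi q hq, fun h i hi q hq => h q ⟨i, hi, hq⟩⟩

lemma C_iff_forall_transGen {φ : Formula n t} {p : Point n t} :
    C φ p ↔ ∀ q, Relation.TransGen Linked p q → φ q := by
  constructor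
  · intro hC q hpq
    induction hpq using Relation.TransGen.head_induction_on with
    | single hpq => exact E_iff_forall_linked.1 (hC 1 le_rfl) q hpq
    | head hps _ ih =>
      refine ih fun k _ => ?_
      have hE := hC (k + 1) (Nat.le_add_left 1 k)
      rw [Function.iterate_succ_apply'] at hE
      exact E_iff_forall_linked.1 hE _ hps
  · intro h k hk
    induction k, hk using Nat.le_induction generalizing p with
    | base => exact E_iff_forall_linked.2 fun q hpq => h q (.single hpq)
    | succ k _ ih =>
      rw [Function.iterate_succ_apply']
      exact E_iff_forall_linked.2 fun q hpq => ih fun s hqs => h s (.head hpq hqs)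

lemma not_C_of_connected {φ : Formula n t} {p q : Point n t} {i : Fin n} (h : Connected p q)
    (hi : q.1.Nonfailed q.2 i) (hφ : ¬ φ q) : ¬ C φ p := fun hC =>
  hφ (C_iff_forall_transGen.1 hC q (Relation.TransGen.tail' h ⟨i, hi, rfl⟩))

lemma IsSBA.exists_decides_of_linked {P : DecisionProtocol n} (hP : IsSBA t P) {p q : Point n t}
    {v : Value} (hpq : Linked p q) (h : ∃ i, Decides P p.1 p.2 i v) :
    ∃ i, Decides P q.1 q.2 i v := by
  obtain ⟨i, hi⟩ := h
  obtain ⟨j, hj, hpq⟩ := hpq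
  obtain ⟨w, hw⟩ := hP.simultaneity _ _ _ _ hi j hj
  obtain rfl := hP.agreement _ _ _ _ _ _ _ hi hw
  exact ⟨j, hpq.nonfailed hj, (congrArg (P j) hpq).symm.trans hw.2⟩

lemma IsSBA.C_existsValue {P : DecisionProtocol n} (hP : IsSBA t P) {r : Run n t} {m : ℕ}
    {i : Fin n} {v : Value} (h : Decides P r m i v) : C (existsValue v) (r, m) := by
  refine C_iff_forall_transGen.2 fun q hq => ?_
  suffices ∃ j, Decides P q.1 q.2 j v from this.elim fun j => hP.validity _ _ j v
  induction hq with
  | single hpq => exact hP.exists_decides_of_linked hpq ⟨i, h⟩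
  | tail _ hqs ih => exact hP.exists_decides_of_linked hqs ih

/-! ### Crashes -/

namespace Run

variable {r : Run n t} {m q : ℕ} {i j k : Fin n}

/-- The messages that reach `i` in round `m + 1`. -/
def inbox (r : Run n t) (m : ℕ) (i : Fin n) : Fin n → Option (Info n) :=
  fun j => if r.F m j i = true then message j (r.state m j) i else none

lemma state_succ : r.state (m + 1) i = transition r.F i (r.state m i) (r.inbox m i) := rfl

lemma nonfailed_zero : r.Nonfailed 0 i := by simp [Nonfailed, state, initState]

lemma Nonfailed.exists_state_eq (h : r.Nonfailed m i) :
    ∃ V New, r.state m i = .active V New m := by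
  induction m with
  | zero => exact ⟨_, _, rfl⟩
  | succ m ih =>
    rw [Nonfailed, state_succ] at h
    have hm : r.Nonfailed m i := fun hc => h (by rw [hc, transition])
    obtain ⟨V, New, hV⟩ := ih hm
    rw [hV, transition] at h
    rw [state_succ, hV, transition]
    split_ifs at h ⊢ with hF
    · exact absurd rfl h
    · exact ⟨_, _, rfl⟩

lemma nonfailed_succ : r.Nonfailed (m + 1) i ↔ r.Nonfailed m i ∧ r.F m i i = true := by
  by_cases h : r.Nonfailed m i
  · obtain ⟨V, New, hV⟩ := h.exists_state_eq
    simp [Nonfailed, state_succ, hV, transition]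
  · have hc : r.state m i = .crashed := not_not.1 h
    simp [Nonfailed, state_succ, hc, transition]

lemma nonfailed_of_delivered (h : r.F m i j = true) : r.Nonfailed m i := by
  induction m generalizing j with
  | zero => exact nonfailed_zero
  | succ m ih =>
    have hself : r.F m i i = true := by
      by_contra hF
      simp [r.isCrash.silent_after m i (by simpa using hF) (m + 1) m.lt_succ_self j] at h
    exact nonfailed_succ.2 ⟨ih hself, hself⟩

lemma nonfailed_succ_iff_delivered_self : r.Nonfailed (m + 1) i ↔ r.F m i i = true :=
  ⟨fun h => (nonfailed_succ.1 h).2, fun h => nonfailed_succ.2 ⟨nonfailed_of_delivered h, h⟩⟩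

lemma Nonfailed.delivered (h : r.Nonfailed (m + 1) i) (j : Fin n) : r.F m i j = true := by
  by_contra hF
  have := r.isCrash.crash_of_lost m i j (by simpa using hF)
  simp [nonfailed_succ_iff_delivered_self.1 h] at this

lemma Nonfailed.mono (h : r.Nonfailed m i) (hq : q ≤ m) : r.Nonfailed q i :=
  Nat.decreasingInduction (motive := fun q _ => r.Nonfailed q i)
    (fun _ _ h => (nonfailed_succ.1 h).1) h hq

open Classical in
/-- The agents that have crashed by time `m`. -/
noncomputable def crashed (r : Run n t) (m : ℕ) : Finset (Fin n) := {i | ¬ r.Nonfailed m i}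

lemma mem_crashed : i ∈ r.crashed m ↔ ¬ r.Nonfailed m i := by simp [crashed]

lemma card_crashed_le (r : Run n t) (m : ℕ) : (r.crashed m).card ≤ t := by
  refine le_trans ?_ r.isCrash.card_faulty
  rw [← Set.ncard_coe_finset]
  refine Set.ncard_le_ncard (fun i hi => ?_) (Set.toFinite _)
  cases m with
  | zero => exact absurd nonfailed_zero (mem_crashed.1 hi)
  | succ m => exact ⟨m, i, by simpa [mem_crashed, nonfailed_succ_iff_delivered_self] using hi⟩

lemma crashed_mono (hq : q ≤ m) : r.crashed q ⊆ r.crashed m := fun _ hi =>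
  mem_crashed.2 fun h => mem_crashed.1 hi (h.mono hq)

end Run

/-! ### Flooding -/

/-- The value vector of an agent that knows the entries of `w` at the agents in `S`. -/
def view (w : Fin n → Value) (S : Finset (Fin n)) : Fin n → Option Value :=
  fun k => if k ∈ S then some (w k) else none

section view

variable {w w' : Fin n → Value} {S S' : Finset (Fin n)} {k : Fin n} {v : Value}

lemma view_eq_none_iff : view w S k = none ↔ k ∉ S := by simp [view]

lemma view_eq_some_iff : view w S k = some v ↔ k ∈ S ∧ w k = v := by simp [view]

lemma view_congr (h : ∀ k ∈ S, w k = w' k) : view w S = view w' S := by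
  funext k
  by_cases hk : k ∈ S <;> simp [view, hk, h]

lemma mem_newInfo_view :
    (v, k) ∈ newInfo (view w S) (view w S') ↔ k ∉ S ∧ k ∈ S' ∧ w k = v := by
  simp [newInfo, view_eq_none_iff, view_eq_some_iff]

lemma updateVec_view {W : Info n} (hS : S ⊆ S')
    (hW : ∀ k ∉ S, ∀ v, (v, k) ∈ W ↔ k ∈ S' ∧ w k = v) :
    updateVec (view w S) W = view w S' := by
  funext k
  by_cases hk : k ∈ S
  · simp [updateVec, view, hk, hS hk]
  · by_cases hk' : k ∈ S'
    · rcases Fin.exists_fin_two.1 ⟨w k, rfl⟩ with h | h <;>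
        simp [updateVec, view, hW k hk, hk, hk', h]
    · simp [updateVec, view, hW k hk, hk, hk']

end view

lemma mem_getD_message {i j : Fin n} {V : Fin n → Option Value} {New : Info n} {m : ℕ}
    {p : Value × Fin n} :
    p ∈ (message i (.active V New m) j).getD ∅ ↔ j ≠ i ∧ p ∈ New := by
  by_cases hN : New = ∅ <;> by_cases hj : j = i <;> simp [message, hN, hj]

namespace Run

variable {r r' : Run n t} {m q : ℕ} {i j k : Fin n} {v : Value}

/-- The agents whose initial value has reached `i` by time `m` through a chain of delivered
messages. -/
def heard (r : Run n t) : ℕ → Fin n → Finset (Fin n)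
  | 0, i => {i}
  | m + 1, i => ({a | r.F m a i = true} : Finset (Fin n)).biUnion (r.heard m)

/-- The component `New` of the state of a nonfailed agent. -/
def news (r : Run n t) : ℕ → Fin n → Info n
  | 0, i => {(r.init i, i)}
  | m + 1, i => newInfo (view r.init (r.heard m i)) (view r.init (r.heard (m + 1) i))

lemma mem_heard_zero : k ∈ r.heard 0 i ↔ k = i := Finset.mem_singleton

lemma mem_heard_succ :
    k ∈ r.heard (m + 1) i ↔ ∃ a, r.F m a i = true ∧ k ∈ r.heard m a := by
  simp [heard]

lemma Nonfailed.heard_subset_succ (h : r.Nonfailed (m + 1) i) :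
    r.heard m i ⊆ r.heard (m + 1) i := fun _ hk =>
  mem_heard_succ.2 ⟨i, h.delivered i, hk⟩

lemma Nonfailed.heard_mono (h : r.Nonfailed m i) (hq : q ≤ m) : r.heard q i ⊆ r.heard m i := by
  induction m, hq using Nat.le_induction with
  | base => exact subset_rfl
  | succ m _ ih => exact (ih (h.mono m.le_succ)).trans h.heard_subset_succ

lemma Nonfailed.mem_heard_self (h : r.Nonfailed m i) : i ∈ r.heard m i :=
  h.heard_mono m.zero_le (mem_heard_zero.2 rfl)

lemma heard_and_init_eq_of_mem_news (h : (v, k) ∈ r.news m i) :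
    k ∈ r.heard m i ∧ r.init k = v := by
  cases m with
  | zero => simp_all [news, mem_heard_zero]
  | succ m => exact (mem_newInfo_view.1 h).2

lemma mem_news_of_delivered (hF : r.F m j i = true) (hj : k ∈ r.heard m j)
    (hi : k ∉ r.heard m i) : (r.init k, k) ∈ r.news m j := by
  cases m with
  | zero => simp_all [news, mem_heard_zero]
  | succ m =>
    refine mem_newInfo_view.2 ⟨fun hk => hi ?_, hj, rfl⟩
    exact mem_heard_succ.2 ⟨j, (nonfailed_of_delivered hF).delivered i, hk⟩

lemma mem_received_inbox
    (hstate : ∀ a, r.Nonfailed m a →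
      r.state m a = .active (view r.init (r.heard m a)) (r.news m a) m)
    (hk : k ∉ r.heard m i) :
    (v, k) ∈ received (r.inbox m i) ↔ k ∈ r.heard (m + 1) i ∧ r.init k = v := by
  have hsender : ∀ a, (v, k) ∈ (r.inbox m i a).getD ∅ ↔
      r.F m a i = true ∧ i ≠ a ∧ (v, k) ∈ r.news m a := by
    intro a
    by_cases hF : r.F m a i = true
    · rw [inbox, if_pos hF, hstate a (nonfailed_of_delivered hF), mem_getD_message]
      simp only [hF, true_and]
    · simp [inbox, hF]
  simp only [received, Finset.mem_biUnion, Finset.mem_univ, true_and, hsender, mem_heard_succ]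
  constructor
  · rintro ⟨a, hF, -, hnews⟩
    obtain ⟨ha, hv⟩ := heard_and_init_eq_of_mem_news hnews
    exact ⟨⟨a, hF, ha⟩, hv⟩
  · rintro ⟨⟨a, hF, ha⟩, rfl⟩
    exact ⟨a, hF, fun hia => hk (hia ▸ ha), mem_news_of_delivered hF ha hk⟩

lemma Nonfailed.state_eq (h : r.Nonfailed m i) :
    r.state m i = .active (view r.init (r.heard m i)) (r.news m i) m := by
  induction m generalizing i with
  | zero =>
    have : (fun k => if k = i then some (r.init i) else none) = view r.init (r.heard 0 i) := by
      funext k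
      by_cases hk : k = i <;> simp [view, mem_heard_zero, hk]
    rw [← this]
    rfl
  | succ m ih =>
    have hV : updateVec (view r.init (r.heard m i)) (received (r.inbox m i)) =
        view r.init (r.heard (m + 1) i) :=
      updateVec_view h.heard_subset_succ fun k hk v => mem_received_inbox (fun a => ih) hk
    simp [state_succ, ih (nonfailed_succ.1 h).1, transition, h.delivered i, hV, news]

lemma Nonfailed.beta_eq (h : r.Nonfailed m i) : r.beta m i = (r.heard m i)ᶜ.card := by
  rw [beta, h.state_eq, unknowns]
  congr 1
  ext k
  simp [view_eq_none_iff]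

lemma beta_zero : r.beta 0 i = n - 1 := by
  rw [nonfailed_zero.beta_eq, heard, Finset.card_compl, Fintype.card_fin, Finset.card_singleton]

lemma Nonfailed.indist_succ (h : r.Nonfailed (m + 1) i) (h' : r'.Nonfailed (m + 1) i)
    (hm : r.heard m i = r'.heard m i) (hs : r.heard (m + 1) i = r'.heard (m + 1) i)
    (hv : ∀ k ∈ r.heard (m + 1) i, r.init k = r'.init k) : Indist i (r, m + 1) (r', m + 1) := by
  simp only [Indist, h.state_eq, h'.state_eq, news, ← hm, ← hs, view_congr hv,
    view_congr fun k hk => hv k (h.heard_subset_succ hk)]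

/-! ### Rounds without crashes -/

/-- All nonfailed agents have heard from the same agents. -/
def Uniform (r : Run n t) (m : ℕ) : Prop :=
  ∀ i j, r.Nonfailed m i → r.Nonfailed m j → r.heard m i = r.heard m j

lemma Uniform.heard_eq (h : r.Uniform m) (hq : m ≤ q) (hi : r.Nonfailed m i)
    (hj : r.Nonfailed q j) : r.heard q j = r.heard m i := by
  induction q, hq using Nat.le_induction generalizing j with
  | base => exact h j i hj hi
  | succ q _ ih =>
    refine Finset.Subset.antisymm (fun k hk => ?_) ?_
    · obtain ⟨a, hF, hk⟩ := mem_heard_succ.1 hk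
      rwa [ih (nonfailed_of_delivered hF)] at hk
    · rw [← ih (hj.mono q.le_succ)]
      exact hj.heard_subset_succ

lemma Uniform.mono (h : r.Uniform m) (hq : m ≤ q) : r.Uniform q := fun _ _ hi hj =>
  (h.heard_eq hq (hi.mono hq) hi).trans (h.heard_eq hq (hi.mono hq) hj).symm

lemma uniform_succ_of_crashed_subset (h : r.crashed (m + 1) ⊆ r.crashed m) :
    r.Uniform (m + 1) := by
  have hsub : ∀ i j, r.heard (m + 1) i ⊆ r.heard (m + 1) j := by
    intro i j k hk
    obtain ⟨a, hF, hk⟩ := mem_heard_succ.1 hk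
    have ha : r.Nonfailed (m + 1) a := by
      by_contra ha
      exact mem_crashed.1 (h (mem_crashed.2 ha)) (nonfailed_of_delivered hF)
    exact mem_heard_succ.2 ⟨a, ha.delivered j, hk⟩
  exact fun i j _ _ => (hsub i j).antisymm (hsub j i)

lemma card_crashed_add_le_of_not_uniform (h : ¬ r.Uniform m) (hq : q ≤ m) :
    (r.crashed q).card + m ≤ (r.crashed m).card + q := by
  induction m, hq using Nat.le_induction with
  | base => rfl
  | succ m _ ih =>
    have hlt : (r.crashed m).card < (r.crashed (m + 1)).card :=
      Finset.card_lt_card ⟨crashed_mono m.le_succ, fun hc => h (uniform_succ_of_crashed_subset hc)⟩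
    have := ih fun hm => h (hm.mono m.le_succ)
    omega

lemma card_crashed_add_two_le_of_not_uniform (h : ¬ r.Uniform m) :
    (r.crashed m).card + 2 ≤ n := by
  have hone : 1 < (r.crashed m)ᶜ.card := by
    by_contra! hle
    refine h fun i j hi hj => ?_
    rw [Finset.card_le_one.1 hle i (by simpa [mem_crashed]) j (by simpa [mem_crashed])]
  rw [Finset.card_compl, Fintype.card_fin] at hone
  omega

lemma Nonfailed.compl_heard_subset_crashed (h : r.Nonfailed (m + 1) i) :
    (r.heard (m + 1) i)ᶜ ⊆ r.crashed 1 := by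
  refine fun k hk => mem_crashed.2 fun h1 => Finset.mem_compl.1 hk ?_
  exact h.heard_mono (Nat.le_add_left 1 m)
    (mem_heard_succ.2 ⟨k, h1.delivered i, mem_heard_zero.2 rfl⟩)

lemma Nonfailed.card_compl_heard_le (h : r.Nonfailed (m + 1) i) :
    (r.heard (m + 1) i)ᶜ.card ≤ (r.crashed 1).card :=
  Finset.card_le_card h.compl_heard_subset_crashed

/-! ### The stopping rule is a simultaneous agreement protocol -/

/-- The condition under which the stopping rule makes the nonfailed agent `i` decide. -/
def Stops (r : Run n t) (m : ℕ) (i : Fin n) : Prop :=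
  (0 < m ∨ n ≤ t + 2) ∧ StopCond n t m (r.beta m i)

lemma Nonfailed.uniform_of_stops (h : r.Nonfailed m i) (hs : r.Stops m i) : r.Uniform m := by
  by_contra hu
  have hcard := card_crashed_add_two_le_of_not_uniform hu
  obtain ⟨hg, hs⟩ := hs
  rw [StopCond] at hs
  cases m with
  | zero =>
    rw [beta_zero] at hs
    omega
  | succ m =>
    have h0 := card_crashed_add_le_of_not_uniform hu (m + 1).zero_le
    have h1 := card_crashed_add_le_of_not_uniform hu (Nat.le_add_left 1 m)
    have hle := r.card_crashed_le (m + 1)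
    have hunheard := h.card_compl_heard_le
    rw [h.beta_eq] at hs
    omega

end Run

variable {r : Run n t} {m m' : ℕ} {i j : Fin n} {v v' : Value}

lemma decides_stopRule_iff :
    Decides (stopRule n t) r m i v ↔ r.Nonfailed m i ∧ r.Stops m i ∧
      v = if ∃ k ∈ r.heard m i, r.init k = 0 then 0 else 1 := by
  refine and_congr_right fun h => ?_
  have hβ : r.beta m i = (Finset.univ.filter fun k =>
      view r.init (r.heard m i) k = none).card := by
    rw [Run.beta, h.state_eq, unknowns]
  rw [h.state_eq, stopRule, Run.Stops, hβ]
  simp only [view_eq_some_iff]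
  split_ifs <;> simp_all [eq_comm]

lemma exists_decides_stopRule_iff :
    (∃ v, Decides (stopRule n t) r m i v) ↔ r.Nonfailed m i ∧ r.Stops m i := by
  simp only [decides_stopRule_iff, exists_and_left, exists_eq, and_true]

lemma stopRule_agreement_of_le (hm : m ≤ m') (h : Decides (stopRule n t) r m i v)
    (h' : Decides (stopRule n t) r m' j v') : v = v' := by
  obtain ⟨hi, hs, rfl⟩ := decides_stopRule_iff.1 h
  obtain ⟨hj, -, rfl⟩ := decides_stopRule_iff.1 h'
  rw [(hi.uniform_of_stops hs).heard_eq hm hi hj]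

lemma stopRule_validity (h : Decides (stopRule n t) r m i v) : ∃ j, r.init j = v := by
  obtain ⟨hi, -, rfl⟩ := decides_stopRule_iff.1 h
  split_ifs with h0
  · exact h0.imp fun k hk => hk.2
  · exact ⟨i, (Fin.exists_fin_two.1 ⟨r.init i, rfl⟩).resolve_left
      fun hi0 => h0 ⟨i, hi.mem_heard_self, hi0⟩⟩

lemma stopRule_simultaneity (h : Decides (stopRule n t) r m i v) (hj : r.Nonfailed m j) :
    ∃ w, Decides (stopRule n t) r m j w := by
  obtain ⟨hi, hs⟩ := exists_decides_stopRule_iff.1 ⟨v, h⟩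
  have hβ : r.beta m i = r.beta m j := by
    rw [hi.beta_eq, hj.beta_eq, hi.uniform_of_stops hs i j hi hj]
  exact exists_decides_stopRule_iff.2 ⟨hj, hs.1, hβ ▸ hs.2⟩

lemma isSBA_stopRule : IsSBA t (stopRule n t) where
  agreement _ m m' _ _ _ _ h h' := (le_total m m').elim
    (fun hm => stopRule_agreement_of_le hm h h')
    (fun hm => (stopRule_agreement_of_le hm h' h).symm)
  validity _ _ _ _ h := stopRule_validity h
  simultaneity _ _ _ _ h _ hj := stopRule_simultaneity h hj

/-! ### Silent runs and relays -/

open Classical in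
/-- The run in which the message from `i` to `j` in round `m + 1` is delivered iff `D m i j`, where
`D m i i` expresses that `i` survives that round. At most the agents in `B` are faulty. -/
noncomputable def Run.ofDelivery (D : ℕ → Fin n → Fin n → Prop) (w : Fin n → Value)
    (delivers_of_self : ∀ m i j, D m i i → D m i j)
    (self_of_delivers_later : ∀ m m' i j, m < m' → D m' i j → D m i i)
    (B : Finset (Fin n)) (hB : B.card ≤ t) (delivers_of_notMem : ∀ m, ∀ i ∉ B, ∀ j, D m i j) :
    Run n t where
  F m i j := decide (D m i j)
  isCrash :=
    { crash_of_lost := fun m i j h => by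
        simp only [decide_eq_false_iff_not] at h ⊢
        exact mt (delivers_of_self m i j) h
      silent_after := fun m i h m' hm j => by
        simp only [decide_eq_false_iff_not] at h ⊢
        exact mt (self_of_delivers_later m m' i j hm) h
      card_faulty := by
        refine le_trans ?_ hB
        rw [← Set.ncard_coe_finset]
        refine Set.ncard_le_ncard ?_ (Set.toFinite _)
        rintro i ⟨m, j, h⟩
        by_contra hi
        exact of_decide_eq_false h (delivers_of_notMem m i hi j) }
  init := w

/-- The run in which the agents in `B` crash in round 1 without sending anything, and no others
crash. -/
noncomputable def silentRun (B : Finset (Fin n)) (hB : B.card ≤ t) (w : Fin n → Value) :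
    Run n t :=
  .ofDelivery (fun _ i _ => i ∉ B) w (fun _ _ _ => id) (fun _ _ _ _ _ => id) B hB
    fun _ _ hi _ => hi

section silentRun

variable {B : Finset (Fin n)} {hB : B.card ≤ t} {w : Fin n → Value}

lemma silentRun_delivered : (silentRun B hB w).F m i j = true ↔ i ∉ B := by
  simp [silentRun, Run.ofDelivery]

lemma silentRun_nonfailed (hi : i ∉ B) : (silentRun B hB w).Nonfailed m i :=
  Run.nonfailed_of_delivered (silentRun_delivered.2 hi : _ = true) (j := i)

lemma silentRun_heard (hi : i ∉ B) : (silentRun B hB w).heard (m + 1) i = Bᶜ := by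
  induction m generalizing i with
  | zero => ext k; simp [Run.mem_heard_succ, Run.mem_heard_zero, silentRun_delivered]
  | succ m ih =>
    ext k
    simp only [Run.mem_heard_succ (m := m + 1), silentRun_delivered]
    exact ⟨fun ⟨_, ha, hk⟩ => ih ha ▸ hk, fun hk => ⟨i, hi, (ih hi).symm ▸ hk⟩⟩

lemma silentRun_beta (hi : i ∉ B) : (silentRun B hB w).beta (m + 1) i = B.card := by
  rw [(silentRun_nonfailed hi).beta_eq, silentRun_heard hi, compl_compl]

end silentRun

/-- Data for a run in which the agents in `K` crash in round 1, those in `B` silently and the others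
after delivering a message to `hop 0` only. For `s < m`, the agent `hop s` crashes in round `s + 2`
and delivers only its message to `hop (s + 1)`, so that `hop m` is the only agent nonfailed at time
`m + 1` that has heard from the agents in `K \ B`. -/
structure Relay (t m : ℕ) (B K : Finset (Fin n)) where
  hop : ℕ → Fin n
  injOn_hop : Set.InjOn hop (Set.Iic m)
  hop_notMem : ∀ s ≤ m, hop s ∉ K
  silent_subset : B ⊆ K
  card_add_le : K.card + m ≤ t

namespace Relay

variable {B K : Finset (Fin n)} {q : ℕ} {k : Fin n} {w : Fin n → Value}

lemma exists_avoiding (hBK : B ⊆ K) (hi : i ∉ K) (ht : K.card + m ≤ t) (hn : K.card + m + 2 ≤ n) :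
    ∃ R : Relay t m B K, ∀ s ≤ m, R.hop s ≠ i := by
  have hcard : (Set.Iic m).encard ≤ (↑((insert i K)ᶜ : Finset (Fin n)) : Set (Fin n)).encard := by
    rw [← Finset.coe_Iic, Set.encard_coe_eq_coe_finsetCard, Set.encard_coe_eq_coe_finsetCard,
      Finset.card_compl, Finset.card_insert_of_notMem hi, Fintype.card_fin, Nat.card_Iic]
    exact_mod_cast (by omega)
  have : Nonempty (Fin n) := ⟨i⟩
  obtain ⟨c, hmem, hinj⟩ := (Set.finite_Iic m).exists_injOn_of_encard_le hcard
  have hc : ∀ s ≤ m, c s ≠ i ∧ c s ∉ K := fun s hs => by simpa [and_comm] using hmem hs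
  exact ⟨⟨c, hinj, fun s hs => (hc s hs).2, hBK, ht⟩, fun s hs => (hc s hs).1⟩

/-- The message from `a` to `j` in round `q + 1` is delivered in the run of the relay. -/
def Delivers (R : Relay t m B K) (q : ℕ) (a j : Fin n) : Prop :=
  (a ∉ K ∧ ∀ s < m, a = R.hop s → q ≤ s) ∨ (q = 0 ∧ a ∉ B ∧ j = R.hop 0) ∨
    ∃ s < m, q = s + 1 ∧ a = R.hop s ∧ j = R.hop (s + 1)

variable (R : Relay t m B K)

lemma hop_inj {s s' : ℕ} (hs : s ≤ m) (hs' : s' ≤ m) : R.hop s = R.hop s' ↔ s = s' :=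
  R.injOn_hop.eq_iff hs hs'

lemma delivers_of_self (q : ℕ) (a j : Fin n) (h : R.Delivers q a a) : R.Delivers q a j := by
  rcases h with h | ⟨rfl, -, rfl⟩ | ⟨s, hs, rfl, rfl, hloop⟩
  · exact .inl h
  · exact .inl ⟨R.hop_notMem 0 m.zero_le, fun s _ _ => s.zero_le⟩
  · exact absurd ((R.hop_inj hs.le hs).1 hloop) s.lt_succ_self.ne

lemma self_of_delivers_later (q q' : ℕ) (a j : Fin n) (hq : q < q') (h : R.Delivers q' a j) :
    R.Delivers q a a := by
  rcases h with ⟨ha, h⟩ | ⟨rfl, -⟩ | ⟨s, hs, rfl, rfl, -⟩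
  · exact .inl ⟨ha, fun s hs has => hq.le.trans (h s hs has)⟩
  · exact absurd hq q.not_lt_zero
  · refine .inl ⟨R.hop_notMem s hs.le, fun s' hs' h => ?_⟩
    exact (R.hop_inj hs.le hs'.le).1 h ▸ Nat.le_of_lt_succ hq

/-- The run described by the relay. -/
noncomputable def run (w : Fin n → Value) : Run n t :=
  .ofDelivery R.Delivers w R.delivers_of_self R.self_of_delivers_later
    (K ∪ (Finset.range m).image R.hop)
    ((Finset.card_union_le _ _).trans <| (Nat.add_le_add_left
      (Finset.card_image_le.trans (Finset.card_range m).le) _).trans R.card_add_le)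
    fun _ a ha _ => by
      simp only [Finset.mem_union, Finset.mem_image, Finset.mem_range, not_or, not_exists,
        not_and] at ha
      exact .inl ⟨ha.1, fun s hs has => absurd has.symm (ha.2 s hs)⟩

variable {R}

lemma run_delivered : (R.run w).F q i j = true ↔ R.Delivers q i j := by
  simp [run, Run.ofDelivery]

lemma run_delivered_of_ne_hop (hi : i ∉ K) (hne : ∀ s < m, i ≠ R.hop s) :
    (R.run w).F q i j = true :=
  run_delivered.2 <| .inl ⟨hi, fun s hs h => absurd h (hne s hs)⟩

lemma run_nonfailed (hi : i ∉ K) (hne : ∀ s < m, i ≠ R.hop s) : (R.run w).Nonfailed q i :=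
  Run.nonfailed_of_delivered (run_delivered_of_ne_hop hi hne) (j := i)

lemma hop_last_ne {s : ℕ} (hs : s < m) : R.hop m ≠ R.hop s :=
  (R.hop_inj le_rfl hs.le).not.2 hs.ne'

lemma run_nonfailed_hop_last : (R.run w).Nonfailed q (R.hop m) :=
  run_nonfailed (R.hop_notMem m le_rfl) fun _ => hop_last_ne

lemma mem_run_heard (hq : q ≤ m) (hi : (R.run w).Nonfailed (q + 1) i) :
    k ∈ (R.run w).heard (q + 1) i ↔ k ∉ K ∨ (k ∉ B ∧ i = R.hop q) := by
  induction q generalizing i with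
  | zero => simp [Run.mem_heard_succ, Run.mem_heard_zero, run_delivered, Delivers]
  | succ q ih =>
    rw [Run.mem_heard_succ]
    constructor
    · rintro ⟨a, hF, hk⟩
      refine ((ih (by omega) (Run.nonfailed_of_delivered hF)).1 hk).imp_right ?_
      rintro ⟨hkB, rfl⟩
      rcases run_delivered.1 hF with ⟨-, h⟩ | ⟨h, -⟩ | ⟨s, -, hs, -, hi⟩
      · exact absurd (h q hq rfl) q.lt_succ_self.not_ge
      · exact absurd h q.succ_ne_zero
      · exact ⟨hkB, Nat.succ_injective hs ▸ hi⟩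
    · rintro (hk | ⟨hk, rfl⟩)
      · exact ⟨i, hi.delivered i, (ih (by omega) (hi.mono q.succ.le_succ)).2 (.inl hk)⟩
      · have hF : (R.run w).F (q + 1) (R.hop q) (R.hop (q + 1)) = true :=
          run_delivered.2 <| .inr <| .inr ⟨q, hq, rfl, rfl, rfl⟩
        exact ⟨_, hF, (ih (by omega) (Run.nonfailed_of_delivered hF)).2 (.inr ⟨hk, rfl⟩)⟩

lemma run_heard_hop_last : (R.run w).heard (m + 1) (R.hop m) = Bᶜ := by
  ext k
  simp only [mem_run_heard le_rfl run_nonfailed_hop_last, and_true, Finset.mem_compl]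
  exact or_iff_right_of_imp (mt (@R.silent_subset k))

lemma run_heard_of_ne_hop (hi : i ∉ K) (hne : ∀ s ≤ m, R.hop s ≠ i) :
    (R.run w).heard (m + 1) i = Kᶜ := by
  ext k
  have hi := run_nonfailed (w := w) (q := m + 1) hi fun s hs => (hne s hs.le).symm
  simp [mem_run_heard le_rfl hi, (hne m le_rfl).symm]

lemma run_heard_add_two (i : Fin n) : (R.run w).heard (m + 2) i = Bᶜ := by
  ext k
  rw [Run.mem_heard_succ, Finset.mem_compl]
  constructor
  · rintro ⟨a, hF, hk⟩
    exact ((mem_run_heard le_rfl (Run.nonfailed_of_delivered hF)).1 hk).elim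
      (mt (@R.silent_subset k)) And.left
  · intro hk
    refine ⟨R.hop m, run_nonfailed_hop_last.delivered i, ?_⟩
    rwa [run_heard_hop_last, Finset.mem_compl]

end Relay

/-! ### Points that fail the stopping condition -/

lemma Run.Nonfailed.connected_silentRun_of_heard_eq (h : r.Nonfailed (m + 1) i)
    {B : Finset (Fin n)} (hB : B.card ≤ t) (hs : r.heard (m + 1) i = Bᶜ)
    (hm : m = 0 ∨ r.heard m i = Bᶜ) {w : Fin n → Value} (hw : ∀ k ∉ B, r.init k = w k) :
    Connected (r, m + 1) (silentRun B hB w, m + 1) := by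
  have hi : i ∉ B := Finset.mem_compl.1 (hs ▸ h.mem_heard_self)
  have hm' : r.heard m i = (silentRun B hB w).heard m i := by
    cases m with
    | zero => rfl
    | succ m => rw [silentRun_heard hi, hm.resolve_left m.succ_ne_zero]
  refine (h.indist_succ (silentRun_nonfailed hi) hm' ?_ ?_).connected h
  · rw [silentRun_heard hi, hs]
  · exact fun k hk => hw k (Finset.mem_compl.1 (hs ▸ hk))

lemma Run.Nonfailed.not_uniform_of_heard_ne (h : r.Nonfailed (m + 1) i)
    (hne : r.heard m i ≠ r.heard (m + 1) i) : ¬ r.Uniform m := by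
  refine fun hu => hne (Finset.Subset.antisymm h.heard_subset_succ fun k hk => ?_)
  obtain ⟨a, hF, hk⟩ := Run.mem_heard_succ.1 hk
  rwa [hu i a (h.mono m.le_succ) (nonfailed_of_delivered hF)]

-- If `i` has just received news, a relay that ends in another agent one round earlier explains
-- them, and that agent has nothing new to hear in the last round.
lemma Run.Nonfailed.connected_silentRun (h : r.Nonfailed (m + 1) i)
    {B : Finset (Fin n)} (hB : B.card ≤ t) (hs : r.heard (m + 1) i = Bᶜ)
    {w : Fin n → Value} (hw : ∀ k ∉ B, r.init k = w k) :
    Connected (r, m + 1) (silentRun B hB w, m + 1) := by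
  by_cases hm : m = 0 ∨ r.heard m i = Bᶜ
  · exact h.connected_silentRun_of_heard_eq hB hs hm hw
  obtain ⟨hm0, hne⟩ := not_or.1 hm
  obtain ⟨m, rfl⟩ := Nat.exists_eq_succ_of_ne_zero hm0
  have hi := h.mono (m + 1).le_succ
  set K := (r.heard (m + 1) i)ᶜ with hK
  have hiK : i ∉ K := by simpa [hK] using hi.mem_heard_self
  have hBK : B ⊆ K := by
    rw [hK, Finset.subset_compl_comm, ← hs]
    exact h.heard_subset_succ
  have hu : ¬ r.Uniform (m + 1) := h.not_uniform_of_heard_ne (hs ▸ hne)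
  have hcrashed := card_crashed_add_le_of_not_uniform hu (Nat.le_add_left 1 m)
  have hKcard : K.card ≤ (r.crashed 1).card := hi.card_compl_heard_le
  have hle := r.card_crashed_le (m + 1)
  have htwo := card_crashed_add_two_le_of_not_uniform hu
  obtain ⟨R, hR⟩ := Relay.exists_avoiding (t := t) (m := m) hBK hiK (by omega) (by omega)
  have hrelay : Connected (r, m + 2) (R.run w, m + 2) := by
    have hrun := Relay.run_nonfailed (w := w) (q := m + 2) hiK fun s hs => (hR s hs.le).symm
    refine (h.indist_succ hrun ?_ ?_ ?_).connected h
    · rw [Relay.run_heard_of_ne_hop hiK hR, hK, compl_compl]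
    · rw [Relay.run_heard_add_two, hs]
    · exact fun k hk => hw k (Finset.mem_compl.1 (hs ▸ hk))
  exact hrelay.trans <| Relay.run_nonfailed_hop_last.connected_silentRun_of_heard_eq hB
    (Relay.run_heard_add_two _) (.inr Relay.run_heard_hop_last) fun _ _ => rfl

/-- The failure-free run. -/
noncomputable def failureFreeRun (t : ℕ) (w : Fin n → Value) : Run n t :=
  silentRun ∅ (Nat.zero_le t) w

lemma failureFreeRun_nonfailed (w : Fin n → Value) (i : Fin n) :
    (failureFreeRun t w).Nonfailed m i :=
  silentRun_nonfailed (Finset.notMem_empty i)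

lemma connected_failureFreeRun {B : Finset (Fin n)} (hB : B.card ≤ t) (ht : B.card + m ≤ t)
    (hn : B.card + m + 2 ≤ n) {w w' : Fin n → Value} (hw : ∀ k ∉ B, w k = w' k) :
    Connected (silentRun B hB w, m + 1) (failureFreeRun t w', m + 1) := by
  obtain ⟨i, hi⟩ : Bᶜ.Nonempty := by
    rw [← Finset.card_pos, Finset.card_compl, Fintype.card_fin]
    omega
  rw [Finset.mem_compl] at hi
  obtain ⟨R, hR⟩ := Relay.exists_avoiding (Finset.empty_subset B) hi ht hn
  have hsilent : Connected (R.run w', m + 1) (silentRun B hB w, m + 1) :=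
    (Relay.run_nonfailed hi fun s hs => (hR s hs.le).symm).connected_silentRun hB
      (Relay.run_heard_of_ne_hop hi hR) fun k hk => (hw k hk).symm
  exact hsilent.symm.trans <| Relay.run_nonfailed_hop_last.connected_silentRun (Nat.zero_le t)
    Relay.run_heard_hop_last fun _ _ => rfl

lemma connected_of_forall_update {p : (Fin n → Value) → Point n t}
    (h : ∀ w k v, Connected (p w) (p (Function.update w k v))) (w w' : Fin n → Value) :
    Connected (p w) (p w') := by
  suffices ∀ S : Finset (Fin n), Connected (p w) (p (S.piecewise w' w)) by
    simpa using this Finset.univ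
  intro S
  induction S using Finset.induction_on with
  | empty => simpa using Relation.ReflTransGen.refl
  | insert k S _ ih =>
    rw [Finset.piecewise_insert]
    exact ih.trans (h _ _ _)

lemma connected_failureFreeRun_init (ht : m + 1 ≤ t) (hn : m + 3 ≤ n) (w w' : Fin n → Value) :
    Connected (failureFreeRun t w, m + 1) (failureFreeRun t w', m + 1) := by
  refine connected_of_forall_update (p := fun w => (failureFreeRun t w, m + 1))
    (fun w k v => ?_) w w'
  have hfree : ∀ w' : Fin n → Value, (∀ j ∉ ({k} : Finset (Fin n)), w j = w' j) →
      Connected (silentRun {k} (by simp; omega) w, m + 1) (failureFreeRun t w', m + 1) :=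
    fun w' hw => connected_failureFreeRun _ (by simp; omega) (by simp; omega) hw
  refine (hfree w fun _ _ => rfl).symm.trans (hfree _ fun j hj => ?_)
  rw [Function.update_of_ne (Finset.notMem_singleton.1 hj)]

lemma not_stopCond_succ_iff {β : ℕ} :
    ¬ StopCond n t (m + 1) β ↔ max 1 β + m ≤ t ∧ max 1 β + m + 2 ≤ n := by
  rw [StopCond]
  omega

lemma Run.Nonfailed.connected_failureFreeRun (h : r.Nonfailed (m + 1) i)
    (hs : ¬ StopCond n t (m + 1) (r.beta (m + 1) i)) (w : Fin n → Value) :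
    Connected (r, m + 1) (failureFreeRun t w, m + 1) := by
  rw [not_stopCond_succ_iff, h.beta_eq] at hs
  set B := (r.heard (m + 1) i)ᶜ with hB
  have hBt : B.card ≤ t := by omega
  calc Connected (r, m + 1) (silentRun B hBt r.init, m + 1) :=
        h.connected_silentRun hBt (by rw [hB, compl_compl]) fun _ _ => rfl
    Connected _ (failureFreeRun t r.init, m + 1) :=
        VecFloodSet.connected_failureFreeRun hBt (by omega) (by omega) fun _ _ => rfl
    Connected _ (failureFreeRun t w, m + 1) :=
        connected_failureFreeRun_init (by omega) (by omega) _ _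

lemma connected_zero_of_two_le (hn : 2 ≤ n) (r : Run n t) (w : Fin n → Value) :
    Connected (r, 0) ({ r with init := w }, 0) := by
  refine connected_of_forall_update (p := fun w => ({ r with init := w }, 0))
    (fun w k v => ?_) r.init w
  have : Nontrivial (Fin n) := Fin.nontrivial_iff_two_le.2 hn
  obtain ⟨i, hi⟩ := exists_ne k
  have hind : Indist i (({ r with init := w }, 0) : Point n t)
      ({ r with init := Function.update w k v }, 0) := by
    simp [Indist, Run.state, hi]
  exact hind.connected Run.nonfailed_zero

lemma not_existsValue_const {p : Point n t} {v v' : Value} (hv : v' ≠ v)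
    (hp : p.1.init = fun _ => v') : ¬ existsValue v p := by
  simp [existsValue, hp, hv]

lemma Run.Nonfailed.stops_of_C_existsValue (h : r.Nonfailed m i)
    (hC : C (existsValue v) (r, m)) : r.Stops m i := by
  obtain ⟨v', hv'⟩ : ∃ v' : Value, v' ≠ v := exists_ne v
  by_contra hs
  cases m with
  | zero =>
    have hn : 2 ≤ n := by
      by_contra hn
      refine hs ⟨.inr (by omega), ?_⟩
      rw [beta_zero, StopCond]
      omega
    exact not_C_of_connected (connected_zero_of_two_le hn r fun _ => v')
      (nonfailed_zero (i := i)) (not_existsValue_const hv' rfl) hC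
  | succ m =>
    exact not_C_of_connected
      (h.connected_failureFreeRun (fun hc => hs ⟨.inl m.succ_pos, hc⟩) fun _ => v')
      (failureFreeRun_nonfailed _ i) (not_existsValue_const hv' rfl) hC

/-! ### Characterization, optimality and decision times -/

lemma Run.Nonfailed.exists_C_existsValue_iff (h : r.Nonfailed m i) :
    (∃ v, C (existsValue v) (r, m)) ↔ r.Stops m i := by
  refine ⟨fun ⟨_, hC⟩ => h.stops_of_C_existsValue hC, fun hs => ?_⟩
  exact (exists_decides_stopRule_iff.2 ⟨h, hs⟩).imp fun _ => isSBA_stopRule.C_existsValue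

lemma isOptimumSBA_stopRule : IsOptimumSBA t (stopRule n t) :=
  ⟨isSBA_stopRule, fun _ hP _ _ _ _ h =>
    exists_decides_stopRule_iff.2 ⟨h.1, h.1.stops_of_C_existsValue (hP.C_existsValue h)⟩⟩

lemma Run.stops_of_lt (hm : t < m) : r.Stops m i :=
  ⟨.inl (by omega), by rw [StopCond]; omega⟩

lemma exists_decides_stopRule_lt (hn : 0 < n) (h : 2 ≤ t ∨ n = t + 1) :
    ∃ (r : Run n t) (m : ℕ) (i : Fin n) (v : Value),
      m < t + 1 ∧ Decides (stopRule n t) r m i v := by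
  suffices ∃ (r : Run n t) (m : ℕ) (i : Fin n), m < t + 1 ∧ r.Nonfailed m i ∧ r.Stops m i by
    obtain ⟨r, m, i, hm, hs⟩ := this
    obtain ⟨v, hv⟩ := exists_decides_stopRule_iff.2 hs
    exact ⟨r, m, i, v, hm, hv⟩
  let i : Fin n := ⟨0, hn⟩
  rcases h with h | rfl
  · obtain ⟨B, hBi, hB⟩ := Finset.exists_subset_card_eq
      (s := Finset.univ.erase i) (n := min t (n - 1)) (by simp)
    have hi : i ∉ B := fun hi => Finset.notMem_erase i _ (hBi hi)
    refine ⟨silentRun B (by omega) 0, 2, i, by omega, silentRun_nonfailed hi, .inl two_pos, ?_⟩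
    rw [silentRun_beta hi, StopCond]
    omega
  · refine ⟨failureFreeRun t 0, t, i, t.lt_succ_self, failureFreeRun_nonfailed 0 i,
      .inr (by omega), ?_⟩
    rw [StopCond]
    omega

end VecFloodSet

theorem mainTheorem7_general (n t : ℕ) (hn : 0 < n) :
    (∀ (r : VecFloodSet.Run n t) (m : ℕ) (i : Fin n), r.Nonfailed m i → (0 < m ∨ n ≤ t + 2) →
      ((VecFloodSet.C (VecFloodSet.existsValue 0) (r, m) ∨
          VecFloodSet.C (VecFloodSet.existsValue 1) (r, m)) ↔
        (m : ℤ) > min ((t : ℤ) + 1) ((n : ℤ) - 1) - max 1 (r.beta m i : ℤ))) ∧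
    VecFloodSet.IsOptimumSBA t (VecFloodSet.stopRule n t) ∧
    (∀ (r : VecFloodSet.Run n t) (i : Fin n), r.Nonfailed (t + 1) i →
      ∃ m ≤ t + 1, ∃ v, VecFloodSet.Decides (VecFloodSet.stopRule n t) r m i v) ∧
    ((2 ≤ t ∨ n = t + 1) → ∃ (r : VecFloodSet.Run n t) (m : ℕ) (i : Fin n) (v : Fin 2),
      m < t + 1 ∧ VecFloodSet.Decides (VecFloodSet.stopRule n t) r m i v) := by
  refine ⟨fun r m i hi hm => ?_, VecFloodSet.isOptimumSBA_stopRule, fun r i hi => ?_,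
    VecFloodSet.exists_decides_stopRule_lt hn⟩
  · rw [← Fin.exists_fin_two (p := fun v => VecFloodSet.C (VecFloodSet.existsValue v) (r, m)),
      hi.exists_C_existsValue_iff]
    exact and_iff_right hm
  · exact ⟨t + 1, le_rfl, VecFloodSet.exists_decides_stopRule_iff.2
      ⟨hi, VecFloodSet.Run.stops_of_lt t.lt_succ_self⟩⟩

theorem mainTheorem7 (n t : ℕ) (ht : t < n) :
    -- characterization of common knowledge
    (∀ (r : VecFloodSet.Run n t) (m : ℕ) (i : Fin n), r.Nonfailed m i → (0 < m ∨ n ≤ t + 2) →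
      ((VecFloodSet.C (VecFloodSet.existsValue 0) (r, m) ∨
          VecFloodSet.C (VecFloodSet.existsValue 1) (r, m)) ↔
        (m : ℤ) > min ((t : ℤ) + 1) ((n : ℤ) - 1) - max 1 (r.beta m i : ℤ))) ∧
    -- the resulting early-stopping rule is an optimum SBA protocol
    VecFloodSet.IsOptimumSBA t (VecFloodSet.stopRule n t) ∧
    -- it never decides later than time t + 1
    (∀ (r : VecFloodSet.Run n t) (i : Fin n), r.Nonfailed (t + 1) i →
      ∃ m ≤ t + 1, ∃ v, VecFloodSet.Decides (VecFloodSet.stopRule n t) r m i v) ∧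
    -- and it sometimes decides strictly earlier
    ((2 ≤ t ∨ n = t + 1) → ∃ (r : VecFloodSet.Run n t) (m : ℕ) (i : Fin n) (v : Fin 2),
      m < t + 1 ∧ VecFloodSet.Decides (VecFloodSet.stopRule n t) r m i v) :=
  mainTheorem7_general n t (Nat.zero_lt_of_lt ht)
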